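/- **Theorem.** Let $G$ be a finitely generated group and let $H$ be a finitely generated subgroup of $G$ such that $e(G)=e(H)=1$. If $H$ is almost malnormal in $G$ and $e(G,H)\ge 2$, then $G$ splits over $H$. Here the terms have the following meaning. Let $G$ be a group and $H$ a subgroup. - A subset of $G$ is *$H$-finite* if it is contained in a union of finitely many right cosets $Hg$. A subset $X\subseteq G$ is *$H$-almost invariant* if $HX=X$ and, for every $g\in G$, the symmetric difference of $X$ and $Xg$ is $H$-finite. - The *number of ends* $e(G,H)\in\{0,1,2,\dots,\infty\}$ of the pair $(G,H)$ is the dimension of the $\mathbb F_2$-vector space (under symmetric difference) of $H$-almost invariant subsets of $G$ modulo the $H$-finite ones. In particular $e(G,H)\ge 2$ if and only if there is an $H$-almost invariant $X\subseteq G$ such that neither $X$ nor $G\setminus X$ is $H$-finite. The number of ends of a group is $e(G)=e(G,\{1\})$, and $e(H)=e(H,\{1\})$. - $H$ is *almost malnormal* in $G$ if, for every $g\in G$, whenever $gHg^{-1}\cap H$ is infinite, then $g\in H$. - $G$ *splits over* $H$ if either $G=A*_H B$ is the amalgamated free product of two subgroups $A,B$ of $G$ that both contain $H$ properly, or $G=A*_H$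 is an HNN extension whose base $A\le G$ contains $H$ and whose stable letter $t\in G$ conjugates $H$ onto a subgroup $tHt^{-1}$ of $A$. -/

import Mathlib

open scoped Pointwise

namespace GroupEnds

variable {G : Type*} [Group G]

/-- A subset `A` of `G` is `H`-finite if it is contained in the union of finitely many
right cosets `Hg`. -/
def HFinite (H : Subgroup G) (A : Set G) : Prop :=
  ∃ F : Set G, F.Finite ∧ A ⊆ (H : Set G) * F

/-- Two subsets of `G` are `H`-almost equal if their symmetric difference is `H`-finite. -/
def AlmostEqual (H : Subgroup G) (X Y : Set G) : Prop :=
  HFinite H (symmDiff X Y)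

/-- `X` is `H`-almost invariant if `HX = X`, and `X` and `Xg` are `H`-almost equal for
every `g` in `G`. -/
def AlmostInvariant (H : Subgroup G) (X : Set G) : Prop :=
  (H : Set G) * X = X ∧ ∀ g : G, AlmostEqual H X ((fun x => x * g) '' X)

theorem HFinite.mono {H : Subgroup G} {A B : Set G} (hB : HFinite H B) (h : A ⊆ B) :
    HFinite H A := by
  obtain ⟨F, hF, hBF⟩ := hB
  exact ⟨F, hF, h.trans hBF⟩

theorem HFinite.union {H : Subgroup G} {A B : Set G} (hA : HFinite H A) (hB : HFinite H B) :
    HFinite H (A ∪ B) := by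
  obtain ⟨F, hF, hAF⟩ := hA
  obtain ⟨F', hF', hBF⟩ := hB
  refine ⟨F ∪ F', hF.union hF', ?_⟩
  rw [Set.mul_union]
  exact Set.union_subset_union hAF hBF

theorem HFinite.empty (H : Subgroup G) : HFinite H (∅ : Set G) :=
  ⟨∅, Set.finite_empty, Set.empty_subset _⟩

theorem mul_eq_self_iff {H : Subgroup G} {X : Set G} :
    (H : Set G) * X = X ↔ ∀ h ∈ H, ∀ x : G, h * x ∈ X ↔ x ∈ X := by
  constructor
  · intro e h hh x
    constructor
    · intro hx
      rw [← e]
      exact ⟨h⁻¹, H.inv_mem hh, h * x, hx, by simp⟩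
    · intro hx
      rw [← e]
      exact ⟨h, hh, x, hx, rfl⟩
  · intro e
    ext x
    constructor
    · rintro ⟨h, hh, y, hy, rfl⟩
      exact (e h hh y).2 hy
    · intro hx
      exact ⟨1, H.one_mem, x, hx, by simp⟩

/-- The `𝔽₂`-vector space of `H`-almost invariant subsets of `G`, where a subset is identified
with its characteristic function (so that addition is symmetric difference). -/
def almostInvariantSets (H : Subgroup G) : Submodule (ZMod 2) (G → ZMod 2) where
  carrier := {f | AlmostInvariant H {x | f x = 1}}
  zero_mem' := by
    have h0 : {x : G | (0 : G → ZMod 2) x = 1} = ∅ := by ext x; simp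
    simp only [Set.mem_ofPred_eq, h0]
    refine ⟨by simp, fun g => ?_⟩
    simpa [AlmostEqual] using HFinite.empty H
  add_mem' := by
    intro a b ha hb
    have key : ∀ p q r s : ZMod 2, ((p + q = 1) ∧ ¬ (r + s = 1)) ∨ ((r + s = 1) ∧ ¬ (p + q = 1)) →
        (((p = 1) ∧ ¬ (r = 1)) ∨ ((r = 1) ∧ ¬ (p = 1))) ∨
        (((q = 1) ∧ ¬ (s = 1)) ∨ ((s = 1) ∧ ¬ (q = 1))) := by decide
    have key' : ∀ p q r s : ZMod 2, (p = 1 ↔ r = 1) → (q = 1 ↔ s = 1) →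
        (p + q = 1 ↔ r + s = 1) := by decide
    refine ⟨mul_eq_self_iff.2 fun h hh x => ?_, fun g => ?_⟩
    · exact key' _ _ _ _ (mul_eq_self_iff.1 ha.1 h hh x) (mul_eq_self_iff.1 hb.1 h hh x)
    · refine ((ha.2 g).union (hb.2 g)).mono fun x hx => ?_
      simp only [Set.image_mul_right, Set.mem_symmDiff, Set.mem_union, Set.mem_preimage,
        Set.mem_ofPred_eq, Pi.add_apply] at hx ⊢
      exact key _ _ _ _ hx
  smul_mem' := by
    intro c a ha
    have hc : c = 0 ∨ c = 1 := by revert c; decide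
    rcases hc with rfl | rfl
    · have h0 : {x : G | ((0 : ZMod 2) • a) x = 1} = ∅ := by ext x; simp
      simp only [Set.mem_ofPred_eq, h0]
      refine ⟨by simp, fun g => ?_⟩
      simpa [AlmostEqual] using HFinite.empty H
    · simpa using ha

/-- The subspace of those `H`-almost invariant subsets of `G` that are `H`-finite. -/
def hFiniteSets (H : Subgroup G) : Submodule (ZMod 2) (almostInvariantSets H) where
  carrier := {f | HFinite H {x | f.1 x = 1}}
  zero_mem' := (HFinite.empty H).mono fun x hx => by simp at hx
  add_mem' := by
    intro a b ha hb
    have key : ∀ p q : ZMod 2, p + q = 1 → p = 1 ∨ q = 1 := by decide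
    exact (ha.union hb).mono fun x hx => key _ _ hx
  smul_mem' := by
    intro c a ha
    have key : ∀ p q : ZMod 2, p * q = 1 → q = 1 := by decide
    exact HFinite.mono ha fun x hx => key _ _ hx

/-- The number of ends `e(G, H)` of the pair `(G, H)`: the dimension over `𝔽₂` of the space of
`H`-almost invariant subsets of `G` modulo the `H`-finite ones, with value `⊤` if this dimension
is infinite. For finitely generated `G` it is the number of ends of the quotient by `H` of a
Cayley graph of `G`. -/
noncomputable def pairEnds (H : Subgroup G) : ℕ∞ :=
  Cardinal.toENat (Module.rank (ZMod 2) (almostInvariantSets H ⧸ hFiniteSets H))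

/-- The number of ends `e(G)` of a group `G`, i.e. `e(G, {1})`. -/
noncomputable def groupEnds (G : Type*) [Group G] : ℕ∞ :=
  pairEnds (⊥ : Subgroup G)

/-- `H` is almost malnormal in `G` if `gHg⁻¹ ∩ H` infinite implies `g ∈ H`. -/
def AlmostMalnormal (H : Subgroup G) : Prop :=
  ∀ g : G, Infinite ↥(H.map (MulAut.conj g).toMonoidHom ⊓ H) → g ∈ H

/-- `G` is an amalgamated free product `A₀ *_H A₁` of two subgroups containing `H` as a proper
subgroup: the homomorphism from the abstract pushout to `G` is an isomorphism. -/
def IsNontrivialAmalgamOver (H : Subgroup G) : Prop :=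
  ∃ (A : Fin 2 → Subgroup G) (hA : ∀ i, H < A i),
    Function.Bijective
      (Monoid.PushoutI.lift (φ := fun i => Subgroup.inclusion (hA i).le)
        (fun i => (A i).subtype) H.subtype (fun _ => rfl))

/-- `G` is an HNN extension `A *_H`: there are a subgroup `A` containing `H`, an isomorphism `φ`
of `H` onto a subgroup `B` of `A`, and a stable letter `t` with `t h t⁻¹ = φ h` for `h ∈ H`, such
that the homomorphism from the abstract HNN extension to `G` is an isomorphism. -/
def IsHNNExtensionOver (H : Subgroup G) : Prop :=
  ∃ (A : Subgroup G) (_ : H ≤ A) (B : Subgroup A) (φ : H.subgroupOf A ≃* B) (t : G)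
    (ht : ∀ a : H.subgroupOf A, t * A.subtype a = A.subtype (φ a) * t),
    Function.Bijective (HNNExtension.lift A.subtype t ht)

/-- `G` splits over `H`: it is a nontrivial amalgamated free product over `H` or an HNN extension
over `H`. -/
def SplitsOver (H : Subgroup G) : Prop :=
  IsNontrivialAmalgamOver H ∨ IsHNNExtensionOver H

end GroupEnds

namespace GroupEnds

/-! Since `e(G,H) ≥ 2`, there is an `H`-almost invariant set `X` such that neither it nor its
complement is `H`-finite. The translates of `X` and `Xᶜ` turn out to be the oriented edges of a tree
on which `G` acts with edge stabilizer `H`.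

The key is nestedness. Let `g ∉ H`. By almost malnormality the coboundary of `gX` meets `H` in a
finite set, so `e(H) = 1` puts almost all of `H` on one side of `gX`; likewise almost all of `gH`
lies on one side of `X`. The corner of `X` and `gX` avoiding both has finite coboundary in `G`,
hence is finite because `e(G) = 1` (`finite_corner`). The order is therefore inclusion up to finite
sets, and `X` never has to be replaced by a strictly nested set. Almost equal translates are equal
(`IsEssential.not_almost_eq_smul`), so this is a partial order and `X` has stabilizer exactly `H`.

Intervals are finite because almost inclusion is honest inclusion outside finitely many double
cosets of `H` (`exists_subset_of_almost_subset`). There is no terminal vertex because `X` would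
otherwise be `H`-finite (`IsEssential.exists_not_finite_inter_smul`).

The passage from the tree to a splitting works in the ordered set of edges: ping-pong gives
injectivity, connectedness gives surjectivity. An amalgam or an HNN extension arises according to
whether the ends of an edge lie in different vertex orbits. -/

/-- A group `G` acting on a partially ordered set `E` with an order-reversing involution `c`, such
that `E` is nested and discrete, consists of the translates of `e₀` and `c e₀`, and no element
of `G` maps `e₀` to `c e₀`. This is the set of oriented edges of a tree with one orbit of
edges and without inversions. -/
structure IsNestedOrbit (G : Type*) {E : Type*} [Group G] [PartialOrder E] [MulAction G E]
    (c : E → E) (e₀ : E) : Prop where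
  compl_compl : ∀ e, c (c e) = e
  compl_le : ∀ e f, e ≤ f → c f ≤ c e
  smul_le : ∀ (g : G) (e f : E), e ≤ f → g • e ≤ g • f
  smul_compl : ∀ (g : G) (e : E), g • c e = c (g • e)
  nested : ∀ e f, e ≤ f ∨ e ≤ c f ∨ c e ≤ f ∨ c e ≤ c f
  not_le_both : ∀ e f, e ≤ f → e ≤ c f → False
  finite_Icc : ∀ e f : E, (Set.Icc e f).Finite
  exists_smul : ∀ e, ∃ g : G, e = g • e₀ ∨ e = g • c e₀
  no_inversion : ∀ g : G, g • e₀ ≠ c e₀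

/-- Two oriented edges have the same initial vertex. -/
def SameVertex {E : Type*} [PartialOrder E] (c : E → E) (e f : E) : Prop :=
  e = f ∨ e ⋖ c f

namespace IsNestedOrbit

/-! ### Vertices and connectedness of the tree -/

section Order

variable {G E : Type*} [Group G] [PartialOrder E] [MulAction G E] {c : E → E} {e₀ : E}

theorem compl_le_iff (S : IsNestedOrbit G c e₀) {e f : E} : c e ≤ f ↔ c f ≤ e :=
  ⟨fun h => by simpa [S.compl_compl] using S.compl_le _ _ h,
    fun h => by simpa [S.compl_compl] using S.compl_le _ _ h⟩

theorem le_compl_iff (S : IsNestedOrbit G c e₀) {e f : E} : e ≤ c f ↔ f ≤ c e :=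
  ⟨fun h => by simpa [S.compl_compl] using S.compl_le _ _ h,
    fun h => by simpa [S.compl_compl] using S.compl_le _ _ h⟩

theorem lt_compl_iff (S : IsNestedOrbit G c e₀) {e f : E} : e < c f ↔ f < c e := by
  rw [lt_iff_le_not_ge, lt_iff_le_not_ge, S.le_compl_iff, S.compl_le_iff]

theorem smul_le_iff (S : IsNestedOrbit G c e₀) (g : G) {e f : E} : g • e ≤ g • f ↔ e ≤ f :=
  ⟨fun h => by simpa using S.smul_le g⁻¹ _ _ h, S.smul_le g e f⟩

theorem smul_lt_iff (S : IsNestedOrbit G c e₀) (g : G) {e f : E} : g • e < g • f ↔ e < f := by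
  rw [lt_iff_le_not_ge, lt_iff_le_not_ge, S.smul_le_iff, S.smul_le_iff]

theorem smul_covBy (S : IsNestedOrbit G c e₀) (g : G) {e f : E} (h : e ⋖ f) : g • e ⋖ g • f := by
  refine ⟨(S.smul_lt_iff g).2 h.1, fun m h1 h2 => ?_⟩
  refine h.2 (c := g⁻¹ • m) ?_ ?_
  · simpa using (S.smul_lt_iff g⁻¹).2 h1
  · simpa using (S.smul_lt_iff g⁻¹).2 h2

theorem covBy_compl_symm (S : IsNestedOrbit G c e₀) {e f : E} (h : e ⋖ c f) : f ⋖ c e := by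
  refine ⟨S.lt_compl_iff.1 h.1, fun m h1 h2 => ?_⟩
  refine h.2 (c := c m) (S.lt_compl_iff.1 h2) ?_
  rw [S.lt_compl_iff, S.compl_compl]
  exact h1

theorem sameVertex_symm (S : IsNestedOrbit G c e₀) {e f : E} (h : SameVertex c e f) :
    SameVertex c f e :=
  h.imp Eq.symm S.covBy_compl_symm

theorem sameVertex_smul (S : IsNestedOrbit G c e₀) (g : G) {e f : E} (h : SameVertex c e f) :
    SameVertex c (g • e) (g • f) := by
  rcases h with rfl | h
  · exact Or.inl rfl
  · exact Or.inr (S.smul_compl g f ▸ S.smul_covBy g h)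

/-- For `e ≠ k`, three of the four nesting relations contradict the two coverings or `not_le_both`.
What remains is `e ≤ c k`, and nesting with `f` excludes anything strictly in between. -/
theorem sameVertex_trans (S : IsNestedOrbit G c e₀) {e f k : E} (h : SameVertex c e f)
    (h' : SameVertex c f k) : SameVertex c e k := by
  rcases h with rfl | h
  · exact h'
  rcases h' with rfl | h'
  · exact Or.inr h
  by_cases hek : e = k
  · exact Or.inl hek
  have hk := S.covBy_compl_symm h'
  have hf := S.covBy_compl_symm h
  rcases S.nested e k with h1 | h1 | h1 | h1
  · exact (h.2 (lt_of_le_of_ne h1 hek) hk.1).elim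
  · right
    refine ⟨lt_of_le_of_ne h1 ?_, fun m h2 h3 => ?_⟩
    · rintro rfl
      exact S.not_le_both f f le_rfl (h'.1.le.trans h.1.le)
    rcases S.nested m f with h4 | h4 | h4 | h4
    · exact S.not_le_both e f (h2.le.trans h4) h.1.le
    · rcases h4.eq_or_lt with rfl | h4
      · exact S.not_le_both k f (S.lt_compl_iff.1 h3 |>.le.trans (S.compl_compl f).le) hk.1.le
      · exact h.2 h2 h4
    · exact S.not_le_both k (c f) (hk.1.le) ((S.lt_compl_iff.1 h3).le.trans (S.compl_le_iff.1
        (by rw [S.compl_compl]; exact S.compl_le_iff.1 h4)))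
    · have h4 : f ≤ m := by simpa [S.compl_compl] using S.compl_le _ _ h4
      rcases h4.eq_or_lt with rfl | h4
      · exact S.not_le_both e f h2.le h.1.le
      · exact h'.2 h4 h3
  · have : f ≤ e := by simpa [S.compl_compl] using S.compl_le _ _ (h1.trans hk.1.le)
    exact (S.not_le_both f f le_rfl (this.trans h.1.le)).elim
  · have h1 : k ≤ e := by simpa [S.compl_compl] using S.compl_le _ _ h1
    exact (hk.2 (lt_of_le_of_ne h1 (Ne.symm hek)) h.1).elim

/-- The stabilizer of the initial vertex of an oriented edge. -/
def vertexStabilizer (S : IsNestedOrbit G c e₀) (e : E) : Subgroup G where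
  carrier := {g | SameVertex c (g • e) e}
  one_mem' := Or.inl (one_smul G e)
  mul_mem' := by
    intro a b ha hb
    change SameVertex c ((a * b) • e) e
    rw [mul_smul]
    exact S.sameVertex_trans (S.sameVertex_smul a hb) ha
  inv_mem' := by
    intro a ha
    change SameVertex c (a⁻¹ • e) e
    simpa using S.sameVertex_symm (S.sameVertex_smul a⁻¹ ha)

theorem mem_vertexStabilizer (S : IsNestedOrbit G c e₀) {e : E} {g : G} :
    g ∈ S.vertexStabilizer e ↔ SameVertex c (g • e) e := Iff.rfl

theorem lt_compl_of_sameVertex {e f : E} (h : SameVertex c e f) (hne : e ≠ f) : e < c f :=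
  (h.resolve_left hne).1

theorem exists_covBy_le (S : IsNestedOrbit G c e₀) {e f : E} (h : e < f) : ∃ m, e ⋖ m ∧ m ≤ f := by
  have hfin : (Set.Ioc e f).Finite := (S.finite_Icc e f).subset Set.Ioc_subset_Icc_self
  obtain ⟨m, hm⟩ := hfin.exists_minimal ⟨f, h, le_rfl⟩
  refine ⟨m, ⟨hm.1.1, fun k h1 h2 => ?_⟩, hm.1.2⟩
  exact h2.not_ge (hm.2 ⟨h1, h2.le.trans hm.1.2⟩ h2.le)

/-- Connectedness of the tree: intervals are finite, so a path of coverings leads from `e₀` or `c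
e₀` to any translate, and each step along it is, after translation, one of the three kinds that `K`
is assumed to contain. -/
theorem eq_top_of_sameVertex (S : IsNestedOrbit G c e₀) (K : Subgroup G)
    (h1 : ∀ x : G, SameVertex c (x • e₀) e₀ → x ∈ K)
    (h2 : ∀ x : G, SameVertex c (x • c e₀) (c e₀) → x ∈ K)
    (h3 : ∀ x : G, SameVertex c (x • e₀) (c e₀) → x ∈ K) : K = ⊤ := by
  have key : ∀ n : ℕ, ∀ e f : E, ∀ g : G, (e = e₀ ∨ e = c e₀) → (f = g • e₀ ∨ f = g • c e₀) →
      e ≤ f → (Set.Icc e f).ncard = n → g ∈ K := by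
    intro n
    induction n using Nat.strong_induction_on with
    | _ n ih =>
    intro e f g he hf hef hn
    rcases hef.eq_or_lt with rfl | hlt
    · rcases he with rfl | rfl <;> rcases hf with hf | hf
      · exact h1 g (Or.inl hf.symm)
      · refine absurd ?_ (S.no_inversion g)
        rw [S.smul_compl] at hf
        rw [hf, S.compl_compl, ← hf]
      · exact absurd hf.symm (S.no_inversion g)
      · exact h2 g (Or.inl hf.symm)
    obtain ⟨m, hm, hmf⟩ := S.exists_covBy_le hlt
    obtain ⟨x, hx⟩ := S.exists_smul m
    have hv : SameVertex c e (c m) := Or.inr (by rwa [S.compl_compl])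
    have hxK : x ∈ K := by
      rcases he with rfl | rfl <;> rcases hx with rfl | rfl
      · refine (K.inv_mem_iff).1 (h3 _ ?_)
        simpa [← S.smul_compl] using S.sameVertex_smul x⁻¹ hv
      · rw [← S.smul_compl, S.compl_compl] at hv
        exact h1 x (S.sameVertex_symm hv)
      · rw [← S.smul_compl] at hv
        exact h2 x (S.sameVertex_symm hv)
      · rw [← S.smul_compl, S.compl_compl] at hv
        exact h3 x (S.sameVertex_symm hv)
    -- Translating by `x⁻¹` brings the second edge `m` of the path back to `e₀` or `c e₀`; the
    -- remaining interval has lost `e`.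
    have hcard : (Set.Icc (x⁻¹ • m) (x⁻¹ • f)).ncard < n := by
      have himg : Set.Icc (x⁻¹ • m) (x⁻¹ • f) = (fun k => x⁻¹ • k) '' Set.Icc m f := by
        ext k
        constructor
        · rintro ⟨ha, hb⟩
          refine ⟨x • k, ⟨?_, ?_⟩, by simp⟩
          · simpa using S.smul_le x _ _ ha
          · simpa using S.smul_le x _ _ hb
        · rintro ⟨k, ⟨ha, hb⟩, rfl⟩
          exact ⟨S.smul_le _ _ _ ha, S.smul_le _ _ _ hb⟩
      rw [himg, Set.ncard_image_of_injective _ (MulAction.injective _), ← hn]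
      refine Set.ncard_lt_ncard ⟨Set.Icc_subset_Icc_left hm.1.le, fun hsub => ?_⟩
        (S.finite_Icc e f)
      exact hm.1.not_ge (hsub ⟨le_rfl, hef⟩).1
    have := ih _ hcard (x⁻¹ • m) (x⁻¹ • f) (x⁻¹ * g)
      (by rcases hx with rfl | rfl <;> simp)
      (by rcases hf with rfl | rfl <;> simp [mul_smul])
      (S.smul_le _ _ _ hmf) rfl
    simpa using K.mul_mem hxK this
  rw [Subgroup.eq_top_iff']
  intro g
  rcases S.nested e₀ (g • e₀) with h | h | h | h
  · exact key _ _ _ g (Or.inl rfl) (Or.inl rfl) h rfl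
  · exact key _ _ _ g (Or.inl rfl) (Or.inr (S.smul_compl _ _).symm) h rfl
  · exact key _ _ _ g (Or.inr rfl) (Or.inl rfl) h rfl
  · exact key _ _ _ g (Or.inr rfl) (Or.inr (S.smul_compl _ _).symm) h rfl

end Order

/-! ### Two orbits of vertices: amalgamated products -/

section Amalgam

open Monoid

variable {G E : Type*} [Group G] [PartialOrder E] [MulAction G E] {c : E → E} {e₀ : E}

/-- Ping-pong for amalgamated products: the vertex stabilizers of the two ends of `e₀`
generate their amalgamated product over `H`. -/
theorem pushout_lift_injective (S : IsNestedOrbit G c e₀) {H : Subgroup G}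
    (hH : ∀ g : G, g • e₀ = e₀ ↔ g ∈ H) {A : Fin 2 → Subgroup G} {D : Fin 2 → E}
    (hD0 : D 0 = e₀) (hD1 : D 1 = c e₀) (hAD : ∀ i, A i = S.vertexStabilizer (D i))
    (hA : ∀ i, H < A i) :
    Function.Injective
      (PushoutI.lift (φ := fun i => Subgroup.inclusion (hA i).le)
        (fun i => (A i).subtype) H.subtype (fun _ => rfl)) := by
  classical
  set φ : ∀ i, H →* A i := fun i => Subgroup.inclusion (hA i).le
  set F := PushoutI.lift (φ := φ) (fun i => (A i).subtype) H.subtype (fun _ => rfl) with hF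
  have hF_of : ∀ i (g : A i), F (PushoutI.of i g) = g := fun i g => PushoutI.lift_of ..
  have hF_base : ∀ h : H, F (PushoutI.base φ h) = h := fun h => PushoutI.lift_base ..
  clear_value F
  have hHc : ∀ g : G, g ∈ H → ∀ i, g • c (D i) = c (D i) := by
    intro g hg i
    rw [← hH] at hg
    have hi : i = 0 ∨ i = 1 := by revert i; decide
    rcases hi with rfl | rfl
    · rw [hD0, S.smul_compl, hg]
    · rw [hD1, S.compl_compl, hg]
  have hHD : ∀ g : G, ∀ i, g • D i = D i → g ∈ H := by
    intro g i h
    have hi : i = 0 ∨ i = 1 := by clear h; revert i; decide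
    rcases hi with rfl | rfl
    · rwa [hD0, hH] at h
    · rw [← hH]
      rw [hD1, S.smul_compl] at h
      rw [← S.compl_compl (g • e₀), h, S.compl_compl]
  have hswap : ∀ i j, i ≠ j → c (D j) = D i := by
    intro i j hij
    have hi : (i = 0 ∧ j = 1) ∨ (i = 1 ∧ j = 0) := by revert i j; decide
    rcases hi with ⟨rfl, rfl⟩ | ⟨rfl, rfl⟩
    · rw [hD0, hD1, S.compl_compl]
    · rw [hD0, hD1]
  have hping : ∀ i (g : A i), g ∉ (φ i).range → (g : G) • D i < c (D i) := by
    intro i g hg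
    refine lt_compl_of_sameVertex ?_ ?_
    · exact (hAD i).le g.2
    · intro h
      exact hg ⟨⟨g, hHD _ i h⟩, rfl⟩
  obtain ⟨d⟩ := PushoutI.NormalWord.transversal_nonempty φ
    (fun i => Subgroup.inclusion_injective (hA i).le)
  -- Here `i` is the index of the first syllable and `k` that of the last. A new first syllable has
  -- index `i ≠ j`, so `c (D j) = D i` feeds the old bound into `hping`.
  have key : ∀ w : PushoutI.NormalWord d,
      (w.fstIdx = none ∧ ∃ h, w.prod = PushoutI.base φ h) ∨
      ∃ i k, w.fstIdx = some i ∧ F w.prod • D k < c (D i) := by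
    intro w
    induction w using PushoutI.NormalWord.consRecOn with
    | empty => exact Or.inl ⟨rfl, 1, by simp⟩
    | cons i g w hmw hgn hgr hw1 ih =>
      right
      rw [PushoutI.NormalWord.prod_cons, map_mul, hF_of]
      simp only [mul_smul]
      have hg := hping i g hgr
      rcases ih with ⟨_, h, hh⟩ | ⟨j, k, hj, hk⟩
      · refine ⟨i, i, rfl, ?_⟩
        rw [hh, hF_base]
        have : (h : G) • D i = D i := by
          rw [← S.compl_compl (D i), S.smul_compl, hHc _ h.2]
        simpa [this] using hg
      · refine ⟨i, k, rfl, ?_⟩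
        rw [hswap i j (fun hij => hmw (hij ▸ hj))] at hk
        exact ((S.smul_lt_iff _).2 hk).trans hg
    | base h w hw ih =>
      rw [PushoutI.NormalWord.prod_smul]
      rcases ih with ⟨h1, h', hh⟩ | ⟨j, k, hj, hk⟩
      · refine Or.inl ⟨?_, h * h', by rw [hh, map_mul]⟩
        rw [PushoutI.NormalWord.base_smul_eq_smul, PushoutI.NormalWord.base_smul_def']
        exact h1
      · refine Or.inr ⟨j, k, ?_, ?_⟩
        · rw [PushoutI.NormalWord.base_smul_eq_smul, PushoutI.NormalWord.base_smul_def']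
          exact hj
        · rw [map_mul, mul_smul, hF_base, ← hHc h h.2 j]
          exact (S.smul_lt_iff _).2 hk
  rw [injective_iff_map_eq_one]
  intro x hx
  have hw : (PushoutI.NormalWord.equiv (d := d) x).prod = x :=
    (PushoutI.NormalWord.equiv (d := d)).symm_apply_apply x
  rcases key (PushoutI.NormalWord.equiv x) with ⟨_, h, hh⟩ | ⟨i, k, _, hk⟩
  · rw [hw] at hh
    rw [hh, hF_base] at hx
    have : h = 1 := Subtype.ext hx
    rw [hh, this, map_one]
  · rw [hw, hx, one_smul] at hk
    by_cases hik : k = i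
    · subst hik
      exact (S.not_le_both _ _ le_rfl hk.le).elim
    · rw [hswap k i hik] at hk
      exact (lt_irrefl _ hk).elim

/-- Hypothesis `hs` says that the two ends of `e₀` are inequivalent. The edges below `e₀` and `c e₀`
provide a second edge at each end; it must be a translate of the first by the vertex stabilizer,
which is therefore larger than `H`. -/
theorem isNontrivialAmalgamOver (S : IsNestedOrbit G c e₀) {H : Subgroup G}
    (hH : ∀ g : G, g • e₀ = e₀ ↔ g ∈ H) (h1 : ∃ f, f < e₀) (h2 : ∃ f, f < c e₀)
    (hs : ∀ s : G, ¬ SameVertex c (s • e₀) (c e₀)) : IsNontrivialAmalgamOver H := by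
  have hHc : ∀ g ∈ H, g • c e₀ = c e₀ := fun g hg => by rw [S.smul_compl, (hH g).2 hg]
  have hcov : ∀ e f, f < c e → ∃ m, SameVertex c m e ∧ m < c e := by
    intro e f hf
    rw [S.lt_compl_iff] at hf
    obtain ⟨m, hm, -⟩ := S.exists_covBy_le hf
    have : SameVertex c e (c m) := Or.inr (by rwa [S.compl_compl])
    refine ⟨c m, S.sameVertex_symm this, ?_⟩
    rw [S.lt_compl_iff, S.compl_compl]
    exact hm.1
  have hlt0 : H < S.vertexStabilizer e₀ := by
    refine lt_of_le_of_ne (fun g hg => Or.inl ((hH g).2 hg)) fun heq => ?_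
    obtain ⟨f, hf⟩ := h2
    obtain ⟨m, hm, hm'⟩ := hcov _ _ hf
    obtain ⟨x, rfl | rfl⟩ := S.exists_smul m
    · have : x ∈ H := by rw [heq]; exact hm
      rw [(hH x).2 this] at hm'
      exact S.not_le_both _ _ le_rfl hm'.le
    · have := S.sameVertex_symm (S.sameVertex_smul x⁻¹ hm)
      rw [inv_smul_smul] at this
      exact hs _ this
  have hlt1 : H < S.vertexStabilizer (c e₀) := by
    refine lt_of_le_of_ne (fun g hg => Or.inl (hHc g hg)) fun heq => ?_
    obtain ⟨f, hf⟩ := h1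
    obtain ⟨m, hm, hm'⟩ := hcov (c e₀) f (by rwa [S.compl_compl])
    obtain ⟨x, rfl | rfl⟩ := S.exists_smul m
    · exact hs _ hm
    · have : x ∈ H := by rw [heq]; exact hm
      rw [hHc x this] at hm'
      exact S.not_le_both _ _ le_rfl hm'.le
  let D : Fin 2 → E := ![e₀, c e₀]
  have hA : ∀ i, H < S.vertexStabilizer (D i) := Fin.forall_fin_two.2 ⟨hlt0, hlt1⟩
  refine ⟨fun i => S.vertexStabilizer (D i), hA, ?_, ?_⟩
  · exact S.pushout_lift_injective hH (D := D) rfl rfl (fun _ => rfl) hA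
  · rw [← MonoidHom.range_eq_top]
    refine S.eq_top_of_sameVertex _ (fun x hx => ?_) (fun x hx => ?_) fun x hx => (hs x hx).elim
    · exact ⟨PushoutI.of 0 ⟨x, hx⟩, PushoutI.lift_of ..⟩
    · exact ⟨PushoutI.of 1 ⟨x, hx⟩, PushoutI.lift_of ..⟩

end Amalgam

/-! ### One orbit of vertices: HNN extensions -/

section HNN

variable {G E : Type*} [Group G] [PartialOrder E] [MulAction G E] {c : E → E} {e₀ : E}

/-- Ping-pong for HNN extensions. -/
theorem hnn_lift_injective (S : IsNestedOrbit G c e₀) {A : Subgroup G} {B C : Subgroup A}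
    (φ : C ≃* B) (t : G) (ht : ∀ a : C, t * A.subtype a = A.subtype (φ a) * t)
    (hA : ∀ a ∈ A, SameVertex c (a • e₀) e₀) (ht₀ : SameVertex c (t • c e₀) e₀)
    (hC : ∀ a : A, (a : G) • e₀ = e₀ → a ∈ C)
    (hB : ∀ a : A, (a : G) • t • e₀ = t • e₀ → a ∈ B) :
    Function.Injective (HNNExtension.lift A.subtype t ht) := by
  set F := HNNExtension.lift A.subtype t ht with hF
  -- Two edges leaving the base vertex, in different `A`-orbits since there are no inversions. The
  -- element `t ^ u` carries the reverse of `D (-u)` to `D u`.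
  let D : ℤˣ → E := fun u => if u = 1 then t • c e₀ else e₀
  have hD1 : D 1 = t • c e₀ := if_pos rfl
  have hDn : D (-1) = e₀ := if_neg (by decide)
  have htD : ∀ u : ℤˣ, t ^ (u : ℤ) • c (D (-u)) = D u := by
    intro u
    rcases Int.units_eq_one_or u with rfl | rfl
    · simp [hD1, hDn]
    · rw [neg_neg, hD1, hDn, ← S.smul_compl, S.compl_compl]
      simp
  have hDA : ∀ u, ∀ a ∈ A, SameVertex c (a • D u) (D (-u)) := by
    intro u a ha
    rcases Int.units_eq_one_or u with rfl | rfl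
    · rw [hD1, hDn]
      exact S.sameVertex_trans (S.sameVertex_smul a ht₀) (hA a ha)
    · rw [neg_neg, hD1, hDn]
      exact S.sameVertex_trans (hA a ha) (S.sameVertex_symm ht₀)
  have hDlt : ∀ u, ∀ a ∈ A, a • D u < c (D (-u)) := by
    intro u a ha
    refine lt_compl_of_sameVertex (hDA u a ha) fun h => ?_
    rcases Int.units_eq_one_or u with rfl | rfl
    · rw [hD1, hDn, smul_smul, S.smul_compl] at h
      refine S.no_inversion (a * t) ?_
      rw [← S.compl_compl ((a * t) • e₀), h]
    · rw [neg_neg, hD1, hDn] at h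
      refine S.no_inversion (t⁻¹ * a) ?_
      rw [mul_smul, h, inv_smul_smul]
  have hDself : ∀ u, ∀ a ∈ A, a • D u = D u ∨ a • D u < c (D u) := by
    intro u a ha
    refine or_iff_not_imp_left.2 fun h => lt_compl_of_sameVertex ?_ h
    have h1 : SameVertex c (D (-u)) (D u) := by
      simpa using hDA (-u) 1 A.one_mem
    exact S.sameVertex_trans (hDA u a ha) h1
  have hDC : ∀ u, ∀ a : A, (a : G) • D (-u) = D (-u) → a ∈ HNNExtension.toSubgroup C B u := by
    intro u a h
    rcases Int.units_eq_one_or u with rfl | rfl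
    · rw [hDn] at h
      exact hC a h
    · rw [neg_neg, hD1, S.smul_compl, S.smul_compl] at h
      refine hB a ?_
      rw [← S.compl_compl (_ • t • e₀), h, S.compl_compl]
  obtain ⟨d⟩ := HNNExtension.NormalWord.TransversalPair.nonempty A C B
  -- Here `u` is the first exponent, `v` the last one and `a` the trailing element of `A`. In the
  -- induction, equal consecutive exponents use `hDlt`; opposite ones use `hDself`, whose equality
  -- case would be a pinch, excluded in a reduced word.
  have key : ∀ w : HNNExtension.NormalWord d,
      (w.toList = [] ∧ ∃ a : A, w.prod φ = HNNExtension.of a) ∨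
      ∃ u v : ℤˣ, ∃ a : A, u ∈ Option.map Prod.fst w.toList.head? ∧
        F (w.prod φ) • (a : G)⁻¹ • c (D (-v)) ≤ (w.head : G) • D u := by
    intro w
    induction w using HNNExtension.NormalWord.consRecOn with
    | ofGroup g => exact Or.inl ⟨rfl, g, by simp [HNNExtension.NormalWord.ReducedWord.prod]⟩
    | cons g u w hd hu ih =>
      right
      have hFc : F ((HNNExtension.NormalWord.cons g u w hd hu).prod φ) =
          (g : G) * (t ^ (u : ℤ) * F (w.prod φ)) := by
        rw [HNNExtension.NormalWord.prod_cons]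
        simp [hF]
      rw [hFc]
      simp only [mul_smul]
      rcases ih with ⟨hnil, a, ha⟩ | ⟨u', v, a, hu', hle⟩
      · refine ⟨u, u, a, by simp, ?_⟩
        rw [ha, hF, HNNExtension.lift_of]
        simp [htD]
      · refine ⟨u, v, a, by simp, ?_⟩
        refine S.smul_le _ _ _ ?_
        rw [← htD u]
        refine S.smul_le _ _ _ (hle.trans ?_)
        rcases eq_or_ne u u' with rfl | hne
        · exact (hDlt u _ w.head.2).le
        · have huu : u' = -u := by
            rcases Int.units_eq_one_or u with rfl | rfl <;>
              rcases Int.units_eq_one_or u' with rfl | rfl <;> simp_all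
          rw [huu]
          refine ((hDself (-u) _ w.head.2).resolve_left fun h => ?_).le
          exact hne (hu u' hu' (hDC u _ h))
  rw [injective_iff_map_eq_one]
  intro x hx
  have hw : (HNNExtension.NormalWord.equiv φ d x).prod φ = x :=
    (HNNExtension.NormalWord.equiv φ d).symm_apply_apply x
  rcases key (HNNExtension.NormalWord.equiv φ d x) with ⟨_, a, ha⟩ | ⟨u, v, a, _, hle⟩
  · rw [hw] at ha
    rw [ha, hF, HNNExtension.lift_of] at hx
    have : a = 1 := Subtype.ext hx
    rw [ha, this, map_one]
  · rw [hw, hx, one_smul] at hle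
    replace hle := S.smul_le (a : G) _ _ hle
    rw [smul_inv_smul, smul_smul] at hle
    set b : G := (a : G) * ((HNNExtension.NormalWord.equiv φ d x).head : G)
    have hb : b ∈ A := A.mul_mem a.2 (SetLike.coe_mem _)
    rcases eq_or_ne u v with rfl | hne
    · exact ((hDlt u b hb).not_ge hle).elim
    · have huu : v = -u := by
        rcases Int.units_eq_one_or u with rfl | rfl <;>
          rcases Int.units_eq_one_or v with rfl | rfl <;> simp_all
      rw [huu, neg_neg] at hle
      rcases hDself u b hb with h | h
      · rw [h] at hle
        refine (S.not_le_both _ _ le_rfl (hle.trans ?_)).elim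
        rw [S.compl_compl]
      · exact (h.not_ge hle).elim

theorem isHNNExtensionOver (S : IsNestedOrbit G c e₀) {H : Subgroup G}
    (hH : ∀ g : G, g • e₀ = e₀ ↔ g ∈ H) {s : G} (hs : SameVertex c (s • e₀) (c e₀)) :
    IsHNNExtensionOver H := by
  -- The inverse is needed: `t` has to bring the terminal vertex of `e₀` to the initial one, so that
  -- `t * h * t⁻¹` fixes an edge at the vertex stabilized by `A`.
  obtain ⟨t, rfl⟩ : ∃ t, s = t⁻¹ := ⟨s⁻¹, by simp⟩
  have ht₀ : SameVertex c (t • c e₀) e₀ := by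
    simpa using S.sameVertex_symm (S.sameVertex_smul t hs)
  set A := S.vertexStabilizer e₀ with hAdef
  have hHA : H ≤ A := fun g hg => Or.inl ((hH g).2 hg)
  have hconj : ∀ h ∈ H, t * h * t⁻¹ ∈ A := by
    intro h hh
    have h1 : (t * h * t⁻¹) • t • c e₀ = t • c e₀ := by
      simp only [mul_smul, inv_smul_smul]
      rw [S.smul_compl h, (hH h).2 hh]
    have h2 := S.sameVertex_smul (t * h * t⁻¹) (S.sameVertex_symm ht₀)
    rw [h1] at h2
    exact S.sameVertex_trans h2 ht₀
  let ψ : H.subgroupOf A →* A :=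
    ((MulAut.conj t).toMonoidHom.comp (A.subtype.comp (H.subgroupOf A).subtype)).codRestrict A
      (fun a => hconj _ a.2)
  have hψ : Function.Injective ψ := by
    intro a b hab
    have := congrArg (A.subtype) hab
    simpa [ψ] using this
  have hψt : ∀ a : H.subgroupOf A, t * A.subtype a = A.subtype (ψ a) * t := by
    intro a
    simp [ψ]
  refine ⟨A, hHA, ψ.range, MonoidHom.ofInjective hψ, t, hψt, ?_, ?_⟩
  · refine S.hnn_lift_injective (MonoidHom.ofInjective hψ) t hψt (fun a ha => ha) ht₀ ?_ ?_
    · intro a ha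
      exact (hH a).1 ha
    · intro a ha
      have : t⁻¹ * a * t ∈ H := by
        rw [← hH]
        simp only [mul_smul]
        rw [ha, inv_smul_smul]
      refine ⟨⟨⟨_, hHA this⟩, this⟩, ?_⟩
      ext
      simp [ψ, mul_assoc]
  · rw [← MonoidHom.range_eq_top]
    set K := (HNNExtension.lift (φ := MonoidHom.ofInjective hψ) A.subtype t hψt).range
    have hAK : ∀ x ∈ A, x ∈ K := fun x hx =>
      ⟨HNNExtension.of ⟨x, hx⟩, HNNExtension.lift_of ..⟩
    have htK : t ∈ K := ⟨HNNExtension.t, HNNExtension.lift_t ..⟩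
    refine S.eq_top_of_sameVertex K hAK (fun x hx => ?_) (fun x hx => ?_)
    · have h1 : t * x * t⁻¹ ∈ A := by
        have h2 := S.sameVertex_smul t hx
        have h3 := S.sameVertex_smul (t * x * t⁻¹) (S.sameVertex_symm ht₀)
        simp only [mul_smul, inv_smul_smul] at h3
        rw [hAdef, mem_vertexStabilizer]
        simp only [mul_smul]
        exact S.sameVertex_trans (S.sameVertex_trans h3 h2) ht₀
      have h4 := K.mul_mem (K.mul_mem (K.inv_mem htK) (hAK _ h1)) htK
      simpa [mul_assoc] using h4
    · have h1 : t * x ∈ A := by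
        have h2 := S.sameVertex_smul t hx
        rw [hAdef, mem_vertexStabilizer, mul_smul]
        exact S.sameVertex_trans h2 ht₀
      simpa using K.mul_mem (K.inv_mem htK) (hAK _ h1)

end HNN

/-- A group acting on the edges of a tree with one orbit of edges, without inversions and without
a terminal vertex, splits over the stabilizer of an edge. -/
theorem splitsOver {G E : Type*} [Group G] [PartialOrder E] [MulAction G E] {c : E → E} {e₀ : E}
    (S : IsNestedOrbit G c e₀) {H : Subgroup G} (hH : ∀ g : G, g • e₀ = e₀ ↔ g ∈ H)
    (h1 : ∃ f, f < e₀) (h2 : ∃ f, f < c e₀) : SplitsOver H := by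
  by_cases hs : ∃ s : G, SameVertex c (s • e₀) (c e₀)
  · obtain ⟨s, hs⟩ := hs
    exact Or.inr (S.isHNNExtensionOver hH hs)
  · exact Or.inl (S.isNontrivialAmalgamOver hH h1 h2 (not_exists.1 hs))

end IsNestedOrbit
-- Numbers of ends in terms of almost invariant sets
section Ends

variable {G : Type*} [Group G] {H : Subgroup G}

theorem almostInvariant_univ (H : Subgroup G) : AlmostInvariant H (Set.univ : Set G) := by
  refine ⟨mul_eq_self_iff.2 (by simp), fun g => ?_⟩
  rw [AlmostEqual, Set.image_univ_of_surjective (Group.mulRight_bijective g).surjective]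
  simpa using HFinite.empty H

/-- The vector of `almostInvariantSets H` corresponding to an almost invariant set. -/
noncomputable def AlmostInvariant.toVector {X : Set G} (hX : AlmostInvariant H X) :
    almostInvariantSets H :=
  ⟨X.indicator 1, by
    have : {x | X.indicator (1 : G → ZMod 2) x = 1} = X := by
      ext x; by_cases hx : x ∈ X <;> simp [hx]
    change AlmostInvariant H _
    rwa [this]⟩

theorem AlmostInvariant.mk_toVector_eq_zero {X : Set G} (hX : AlmostInvariant H X) :
    (hFiniteSets H).mkQ hX.toVector = 0 ↔ HFinite H X := by
  have : {x | X.indicator (1 : G → ZMod 2) x = 1} = X := by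
    ext x; by_cases hx : x ∈ X <;> simp [hx]
  rw [Submodule.mkQ_apply, Submodule.Quotient.mk_eq_zero]
  change HFinite H {x | X.indicator (1 : G → ZMod 2) x = 1} ↔ _
  rw [this]

theorem AlmostInvariant.mk_toVector_eq_univ {X : Set G} (hX : AlmostInvariant H X) :
    (hFiniteSets H).mkQ hX.toVector = (hFiniteSets H).mkQ (almostInvariant_univ H).toVector ↔
      HFinite H Xᶜ := by
  have : {x | (X.indicator 1 - Set.univ.indicator 1 : G → ZMod 2) x = 1} = Xᶜ := by
    ext x; by_cases hx : x ∈ X <;> simp [hx]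
  rw [Submodule.mkQ_apply, Submodule.mkQ_apply, Submodule.Quotient.eq]
  change HFinite H {x | (X.indicator 1 - Set.univ.indicator 1 : G → ZMod 2) x = 1} ↔ _
  rw [this]

theorem exists_eq_mk_toVector (v : almostInvariantSets H ⧸ hFiniteSets H) :
    ∃ (X : Set G) (hX : AlmostInvariant H X), v = (hFiniteSets H).mkQ hX.toVector := by
  obtain ⟨f, rfl⟩ := (hFiniteSets H).mkQ_surjective v
  refine ⟨{x | f.1 x = 1}, f.2, congrArg _ (Subtype.ext ?_)⟩
  ext x
  have key : ∀ p : ZMod 2, p ≠ 1 → p = 0 := by decide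
  by_cases hx : f.1 x = 1
  · simp [AlmostInvariant.toVector, hx]
  · simp [AlmostInvariant.toVector, key _ hx]

/-- A one-dimensional space over `𝔽₂` has only two vectors. The class of the whole group is nonzero,
so every class is zero or that one. -/
theorem hFinite_or_compl_of_pairEnds_eq_one (h : pairEnds H = 1) :
    ¬ HFinite H (Set.univ : Set G) ∧
      ∀ X : Set G, AlmostInvariant H X → HFinite H X ∨ HFinite H Xᶜ := by
  have h1 : Module.rank (ZMod 2) (almostInvariantSets H ⧸ hFiniteSets H) = 1 := by
    rw [pairEnds] at h
    exact Cardinal.toENat_eq_one.1 h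
  obtain ⟨v, hv, hall⟩ := rank_eq_one_iff.1 h1
  have key : ∀ w, w = 0 ∨ w = v := by
    intro w
    obtain ⟨r, rfl⟩ := hall w
    have hr : r = 0 ∨ r = 1 := by revert r; decide
    rcases hr with rfl | rfl <;> simp
  have huniv : ¬ HFinite H (Set.univ : Set G) := by
    intro hfin
    obtain ⟨X, hX, rfl⟩ := exists_eq_mk_toVector v
    exact hv (hX.mk_toVector_eq_zero.2 (hfin.mono (Set.subset_univ _)))
  refine ⟨huniv, fun X hX => ?_⟩
  have hone := (key ((hFiniteSets H).mkQ (almostInvariant_univ H).toVector)).resolve_left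
    fun h0 => huniv ((almostInvariant_univ H).mk_toVector_eq_zero.1 h0)
  rcases key ((hFiniteSets H).mkQ hX.toVector) with h0 | h0
  · exact Or.inl (hX.mk_toVector_eq_zero.1 h0)
  · exact Or.inr (hX.mk_toVector_eq_univ.1 (h0.trans hone.symm))

theorem exists_not_hFinite_of_two_le_pairEnds (h : 2 ≤ pairEnds H) :
    ∃ X : Set G, AlmostInvariant H X ∧ ¬ HFinite H X ∧ ¬ HFinite H Xᶜ := by
  by_contra! hcon
  have h1 : Module.rank (ZMod 2) (almostInvariantSets H ⧸ hFiniteSets H) ≤ 1 := by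
    refine rank_le_one_iff.2 ⟨(hFiniteSets H).mkQ (almostInvariant_univ H).toVector, fun v => ?_⟩
    obtain ⟨X, hX, rfl⟩ := exists_eq_mk_toVector v
    by_cases hfin : HFinite H X
    · exact ⟨0, by rw [zero_smul, hX.mk_toVector_eq_zero.2 hfin]⟩
    · exact ⟨1, by rw [one_smul, hX.mk_toVector_eq_univ.2 (hcon X hX hfin)]⟩
  have h2 : pairEnds H ≤ 1 := by
    rw [pairEnds]
    exact Cardinal.toENat_le_one.2 h1
  exact absurd (h.trans h2) (by decide)

theorem hFinite_bot_iff {A : Set G} : HFinite (⊥ : Subgroup G) A ↔ A.Finite := by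
  constructor
  · rintro ⟨F, hF, hA⟩
    exact hF.subset (by simpa using hA)
  · intro hA
    exact ⟨A, hA, by simp⟩

theorem infinite_of_groupEnds_eq_one (h : groupEnds G = 1) : Infinite G := by
  have := (hFinite_or_compl_of_pairEnds_eq_one h).1
  rw [hFinite_bot_iff] at this
  exact Set.infinite_univ_iff.1 this

/-- In a one-ended group, a subset with finite coboundary is finite or cofinite. -/
theorem finite_or_compl_of_groupEnds_eq_one (h : groupEnds G = 1) {Y : Set G}
    (hY : ∀ k : G, {x | x ∈ Y ∧ x * k ∉ Y}.Finite) : Y.Finite ∨ Yᶜ.Finite := by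
  have := (hFinite_or_compl_of_pairEnds_eq_one h).2 Y ?_
  · simpa only [hFinite_bot_iff] using this
  refine ⟨by simp, fun k => ?_⟩
  rw [AlmostEqual, hFinite_bot_iff, Set.symmDiff_def]
  refine Set.Finite.union ((hY k⁻¹).subset ?_) (((hY k).image (· * k)).subset ?_)
  · rintro x ⟨hx, hxk⟩
    exact ⟨hx, fun hx' => hxk ⟨_, hx', by simp⟩⟩
  · rintro _ ⟨⟨x, hx, rfl⟩, hxk⟩
    exact ⟨x, ⟨hx, hxk⟩, rfl⟩

end Ends

/-! ### Essential sets and finite corners -/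

section Essential

variable {G : Type*} [Group G] {H : Subgroup G}

/-- An `H`-almost invariant set such that neither it nor its complement is `H`-finite. -/
structure IsEssential (H : Subgroup G) (U : Set G) : Prop where
  mul_mem_iff : ∀ h ∈ H, ∀ x, h * x ∈ U ↔ x ∈ U
  hFinite_coboundary : ∀ k, HFinite H {x | ¬ (x ∈ U ↔ x * k ∈ U)}
  not_hFinite : ¬ HFinite H U
  not_hFinite_compl : ¬ HFinite H Uᶜ

theorem IsEssential.compl {U : Set G} (hU : IsEssential H U) : IsEssential H Uᶜ where
  mul_mem_iff h hh x := not_congr (hU.mul_mem_iff h hh x)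
  hFinite_coboundary k := (hU.hFinite_coboundary k).mono fun x hx h => hx (not_congr h)
  not_hFinite := hU.not_hFinite_compl
  not_hFinite_compl := by rw [_root_.compl_compl]; exact hU.not_hFinite

theorem AlmostInvariant.isEssential {X : Set G} (hX : AlmostInvariant H X)
    (h1 : ¬ HFinite H X) (h2 : ¬ HFinite H Xᶜ) : IsEssential H X where
  mul_mem_iff := mul_eq_self_iff.1 hX.1
  hFinite_coboundary k := by
    refine (hX.2 k⁻¹).mono fun x hx => ?_
    simp only [Set.image_mul_right, Set.mem_symmDiff, Set.mem_preimage, inv_inv]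
    by_cases h : x ∈ X <;> by_cases h' : x * k ∈ X
    · exact (hx (iff_of_true h h')).elim
    · exact Or.inl ⟨h, h'⟩
    · exact Or.inr ⟨h', h⟩
    · exact (hx (iff_of_false h h')).elim
  not_hFinite := h1
  not_hFinite_compl := h2

theorem hFinite_of_finite {A : Set G} (hA : A.Finite) : HFinite H A :=
  ⟨A, hA, fun x hx => ⟨1, H.one_mem, x, hx, one_mul x⟩⟩

theorem hFinite_biUnion {ι : Type*} {I : Set ι} (hI : I.Finite) {A : ι → Set G}
    (hA : ∀ i ∈ I, HFinite H (A i)) : HFinite H (⋃ i ∈ I, A i) := by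
  induction I, hI using Set.Finite.induction_on with
  | empty => simpa using HFinite.empty H
  | insert _ _ ih =>
    rw [Set.biUnion_insert]
    exact (hA _ (Set.mem_insert _ _)).union (ih fun i hi => hA i (Set.mem_insert_of_mem _ hi))

theorem hFinite_coset (H : Subgroup G) (x : G) : HFinite H {y | y * x⁻¹ ∈ H} :=
  ⟨{x}, Set.finite_singleton x, fun y hy => ⟨y * x⁻¹, hy, x, rfl, by simp⟩⟩

theorem infinite_coset [Infinite H] (x : G) : {y | y * x⁻¹ ∈ H}.Infinite := by
  refine Set.infinite_of_injective_forall_mem (f := fun h : H => (h : G) * x) ?_ ?_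
  · intro a b hab
    exact Subtype.ext (mul_right_cancel hab)
  · intro h
    change (h : G) * x * x⁻¹ ∈ H
    simp

theorem IsEssential.coset_subset {U : Set G} (hU : IsEssential H U) {x : G} (hx : x ∈ U) :
    {y | y * x⁻¹ ∈ H} ⊆ U := by
  intro y hy
  have := (hU.mul_mem_iff _ hy x).2 hx
  simpa using this

theorem IsEssential.nonempty {U : Set G} (hU : IsEssential H U) : U.Nonempty := by
  rw [Set.nonempty_iff_ne_empty]
  rintro rfl
  exact hU.not_hFinite (HFinite.empty H)

theorem IsEssential.infinite {U : Set G} (hU : IsEssential H U) : U.Infinite :=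
  fun h => hU.not_hFinite (hFinite_of_finite h)

theorem IsEssential.smul_eq {U : Set G} (hU : IsEssential H U) {g : G} (hg : g ∈ H) :
    g • U = U := by
  ext x
  rw [Set.mem_smul_set_iff_inv_smul_mem]
  exact hU.mul_mem_iff _ (H.inv_mem hg) x

theorem coboundary_smul (g k : G) (V : Set G) :
    {x | ¬ (x ∈ g • V ↔ x * k ∈ g • V)} = g • {x | ¬ (x ∈ V ↔ x * k ∈ V)} := by
  ext x
  simp [Set.mem_smul_set_iff_inv_smul_mem, mul_assoc]

/-- A nonempty intersection of `Hf` and `gHf'` is a right coset of `gHg⁻¹ ∩ H`, which is finite for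
`g ∉ H`. -/
theorem AlmostMalnormal.finite_inter_smul (hmal : AlmostMalnormal H) {g : G} (hg : g ∉ H)
    {A B : Set G} (hA : HFinite H A) (hB : HFinite H B) : (A ∩ g • B).Finite := by
  obtain ⟨F, hF, hAF⟩ := hA
  obtain ⟨F', hF', hBF⟩ := hB
  have hfin : ((H.map (MulAut.conj g).toMonoidHom ⊓ H : Subgroup G) : Set G).Finite := by
    by_contra h
    exact hg (hmal g (Set.infinite_coe_iff.2 h))
  have hone : ∀ f f' : G, {x | x * f⁻¹ ∈ H ∧ g⁻¹ * x * f'⁻¹ ∈ H}.Finite := by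
    intro f f'
    rcases Set.eq_empty_or_nonempty {x | x * f⁻¹ ∈ H ∧ g⁻¹ * x * f'⁻¹ ∈ H} with h | ⟨y, hy1, hy2⟩
    · rw [h]; exact Set.finite_empty
    refine (hfin.image (· * y)).subset ?_
    rintro x ⟨hx1, hx2⟩
    refine ⟨x * y⁻¹, ⟨?_, ?_⟩, by simp⟩
    · refine ⟨g⁻¹ * x * f'⁻¹ * (g⁻¹ * y * f'⁻¹)⁻¹, H.mul_mem hx2 (H.inv_mem hy2), ?_⟩
      simp [mul_assoc]
    · simpa [mul_assoc] using H.mul_mem hx1 (H.inv_mem hy1)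
  refine (hF.biUnion fun f _ => hF'.biUnion fun f' _ => hone f f').subset ?_
  rintro x ⟨hxA, hxB⟩
  obtain ⟨h, hh, f, hf, rfl⟩ := hAF hxA
  obtain ⟨h', hh', f', hf', he⟩ := hBF (Set.mem_smul_set_iff_inv_smul_mem.1 hxB)
  simp only [Set.mem_iUnion]
  refine ⟨f, hf, f', hf', by simpa using hh, ?_⟩
  simp only [smul_eq_mul] at he
  rw [← he]
  simpa using hh'

/-- Right multiplication by `f` carries `H` to `Hf` and changes membership in `W` only at the
finitely many coboundary points on `H`. -/
theorem finite_inter_of_finite_inter_subgroup {W : Set G}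
    (hW : ∀ k, ∀ A, HFinite H A → (A ∩ {x | ¬ (x ∈ W ↔ x * k ∈ W)}).Finite)
    (h : ((H : Set G) ∩ W).Finite) {A : Set G} (hA : HFinite H A) : (A ∩ W).Finite := by
  obtain ⟨F, hF, hAF⟩ := hA
  have hHfin : HFinite H (H : Set G) := by simpa using hFinite_coset H 1
  refine (hF.biUnion fun f _ => (h.union (hW f _ hHfin)).image (· * f)).subset ?_
  rintro x ⟨hxA, hxW⟩
  obtain ⟨y, hy, f, hf, rfl⟩ := hAF hxA
  simp only [Set.mem_iUnion]
  refine ⟨f, hf, y, ?_, rfl⟩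
  by_cases hyW : y ∈ W
  · exact Or.inl ⟨hy, hyW⟩
  · exact Or.inr ⟨hy, fun hiff => hyW (hiff.2 hxW)⟩

/-- A one-ended subgroup lies essentially on one side of a set with finite coboundary along it. -/
theorem hFinite_inter_finite_or (hH : groupEnds H = 1) {W : Set G}
    (hW : ∀ k, ∀ A, HFinite H A → (A ∩ {x | ¬ (x ∈ W ↔ x * k ∈ W)}).Finite) :
    (∀ A, HFinite H A → (A ∩ W).Finite) ∨ (∀ A, HFinite H A → (A ∩ Wᶜ).Finite) := by
  have hHfin : HFinite H (H : Set G) := by simpa using hFinite_coset H 1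
  have himage : ∀ Z : Set G, ((↑) ⁻¹' Z : Set H).Finite → ((H : Set G) ∩ Z).Finite := by
    intro Z hZ
    refine (hZ.image (↑)).subset ?_
    rintro x ⟨hx, hxZ⟩
    exact ⟨⟨x, hx⟩, hxZ, rfl⟩
  have hcob : ∀ k : H, {x : H | x ∈ ((↑) ⁻¹' W : Set H) ∧ x * k ∉ ((↑) ⁻¹' W : Set H)}.Finite := by
    intro k
    refine Set.Finite.subset ((hW k _ hHfin).preimage Subtype.val_injective.injOn) ?_
    rintro x ⟨hx, hxk⟩
    exact ⟨x.2, fun h => hxk (h.1 hx)⟩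
  rcases finite_or_compl_of_groupEnds_eq_one hH hcob with h | h
  · exact Or.inl fun A hA => finite_inter_of_finite_inter_subgroup hW (himage W h) hA
  · refine Or.inr fun A hA => finite_inter_of_finite_inter_subgroup (fun k A hA => ?_)
      (himage Wᶜ h) hA
    refine (hW k A hA).subset ?_
    rintro x ⟨hx, hx'⟩
    exact ⟨hx, fun h => hx' (not_congr h)⟩

theorem IsEssential.inter_smul_finite_or (hmal : AlmostMalnormal H) (hH : groupEnds H = 1)
    {V : Set G} (hV : IsEssential H V) {g : G} (hg : g ∉ H) :
    (∀ A, HFinite H A → (A ∩ g • V).Finite) ∨ (∀ A, HFinite H A → (A ∩ g • Vᶜ).Finite) := by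
  rw [Set.smul_set_compl]
  refine hFinite_inter_finite_or hH fun k A hA => ?_
  rw [coboundary_smul]
  exact hmal.finite_inter_smul hg hA (hV.hFinite_coboundary k)

theorem IsEssential.smul_inter_finite_or (hmal : AlmostMalnormal H) (hH : groupEnds H = 1)
    {U : Set G} (hU : IsEssential H U) {g : G} (hg : g ∉ H) :
    (∀ B, HFinite H B → (U ∩ g • B).Finite) ∨ (∀ B, HFinite H B → (Uᶜ ∩ g • B).Finite) := by
  have key : ∀ W B : Set G, (B ∩ g⁻¹ • W).Finite → (W ∩ g • B).Finite := by
    intro W B h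
    have := h.smul_set (a := g)
    rwa [Set.smul_set_inter, smul_inv_smul, Set.inter_comm] at this
  refine (hU.inter_smul_finite_or hmal hH (mt H.inv_mem_iff.1 hg)).imp ?_ ?_
  · exact fun h B hB => key _ _ (h B hB)
  · exact fun h B hB => key _ _ (h B hB)

/-- A step out of the corner crosses the coboundary of `U` inside `g • V`, or that of `g • V` inside
`U`; both sets are finite. The corner is not cofinite, as it misses the infinite set `Uᶜ`. -/
theorem finite_corner (hG : groupEnds G = 1) {U V : Set G} (hU : IsEssential H U)
    (hV : IsEssential H V) {g : G} (h1 : ∀ A, HFinite H A → (A ∩ g • V).Finite)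
    (h2 : ∀ B, HFinite H B → (U ∩ g • B).Finite) : (U ∩ g • V).Finite := by
  refine (finite_or_compl_of_groupEnds_eq_one hG fun k => ?_).resolve_right fun h =>
    hU.compl.infinite (h.subset (Set.compl_subset_compl.2 Set.inter_subset_left))
  refine ((h1 _ (hU.hFinite_coboundary k)).union (h2 _ (hV.hFinite_coboundary k))).subset ?_
  rintro x ⟨⟨hxU, hxV⟩, hxk⟩
  by_cases hxkU : x * k ∈ U
  · refine Or.inr ⟨hxU, ?_⟩
    rw [← coboundary_smul]
    exact fun h => hxk ⟨hxkU, h.1 hxV⟩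
  · exact Or.inl ⟨fun h => hxkU (h.1 hxU), hxV⟩

/-- For `g ∉ H` some corner of the pair `U`, `g • V` is finite. -/
theorem exists_finite_corner (hG : groupEnds G = 1) (hmal : AlmostMalnormal H)
    (hH : groupEnds H = 1) {U V : Set G} (hU : IsEssential H U) (hV : IsEssential H V) {g : G}
    (hg : g ∉ H) : (U ∩ g • V).Finite ∨ (U ∩ g • Vᶜ).Finite ∨ (Uᶜ ∩ g • V).Finite ∨
      (Uᶜ ∩ g • Vᶜ).Finite := by
  rcases hV.inter_smul_finite_or hmal hH hg with h1 | h1 <;>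
    rcases hU.smul_inter_finite_or hmal hH hg with h2 | h2
  · exact Or.inl (finite_corner hG hU hV h1 h2)
  · exact Or.inr (Or.inr (Or.inl (finite_corner hG hU.compl hV h1 h2)))
  · exact Or.inr (Or.inl (finite_corner hG hU hV.compl h1 h2))
  · exact Or.inr (Or.inr (Or.inr (finite_corner hG hU.compl hV.compl h1 h2)))

/-- All cosets `Hx` lie almost entirely on the same side of `g • V`, whereas `U` and `Uᶜ` each
contain such an infinite coset. -/
theorem IsEssential.not_almost_eq_smul (hmal : AlmostMalnormal H) (hH : groupEnds H = 1)
    {U V : Set G} (hU : IsEssential H U) (hV : IsEssential H V) {g : G}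
    (hg : g ∉ H) (h1 : (U \ g • V).Finite) (h2 : (g • V \ U).Finite) : False := by
  have := infinite_of_groupEnds_eq_one hH
  rcases hV.inter_smul_finite_or hmal hH hg with h | h
  · obtain ⟨x, hx⟩ := hU.nonempty
    refine infinite_coset (H := H) x (((h _ (hFinite_coset H x)).union h1).subset ?_)
    intro y hy
    by_cases hyV : y ∈ g • V
    · exact Or.inl ⟨hy, hyV⟩
    · exact Or.inr ⟨hU.coset_subset hx hy, hyV⟩
  · obtain ⟨x, hx⟩ := hU.compl.nonempty
    refine infinite_coset (H := H) x (((h _ (hFinite_coset H x)).union h2).subset ?_)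
    intro y hy
    by_cases hyV : y ∈ g • V
    · exact Or.inr ⟨hyV, hU.compl.coset_subset hx hy⟩
    · exact Or.inl ⟨hy, by rwa [Set.smul_set_compl]⟩

/-! ### Finiteness up to double cosets -/

/-- The coset `Hf` is connected under right multiplication by the elements `f⁻¹ * t * f`, with `t` a
generator of `H`. If `g • V` cuts it, some `h * f` lies in the coboundary of `g • V` for such a
step, which confines `g` to finitely many double cosets. -/
theorem IsEssential.exists_not_crossing (hHfg : H.FG) {V : Set G} (hV : IsEssential H V) (f : G) :
    ∃ Q : Set G, Q.Finite ∧ ∀ g, (∃ h ∈ H, ∃ q ∈ Q, ∃ h' ∈ H, g = h * q * h') ∨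
      (∀ h ∈ H, h * f ∈ g • V) ∨ (∀ h ∈ H, h * f ∉ g • V) := by
  have hfg : Monoid.FG H := Group.fg_iff_monoid_fg.1 ((Group.fg_iff_subgroup_fg H).2 hHfg)
  obtain ⟨T, hT⟩ := hfg.fg_top
  choose F hF hVF using fun k => hV.hFinite_coboundary k
  refine ⟨⋃ t ∈ (T : Set H), (fun q => f * q⁻¹) '' F (f⁻¹ * t * f),
    T.finite_toSet.biUnion fun t _ => (hF _).image _, fun g => ?_⟩
  refine or_iff_not_imp_left.2 fun hg => ?_
  have step : ∀ t ∈ T, ∀ h : H, (h : G) * f ∈ g • V ↔ ((h * t : H) : G) * f ∈ g • V := by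
    intro t ht h
    by_contra hne
    have hmem : (h : G) * f ∈ {x | ¬ (x ∈ g • V ↔ x * (f⁻¹ * t * f) ∈ g • V)} := by
      simpa [mul_assoc] using hne
    rw [coboundary_smul, Set.mem_smul_set_iff_inv_smul_mem] at hmem
    obtain ⟨h', hh', q, hq, he⟩ := hVF _ hmem
    refine hg ⟨h, h.2, f * q⁻¹, ?_, h'⁻¹, H.inv_mem hh', ?_⟩
    · simp only [Set.mem_iUnion]
      exact ⟨t, ht, q, hq, rfl⟩
    · simp only [smul_eq_mul] at he
      have : q⁻¹ = (g⁻¹ * (h * f))⁻¹ * h' := by rw [← he]; group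
      rw [this]
      group
  have all : ∀ h : H, f ∈ g • V ↔ (h : G) * f ∈ g • V := by
    intro h
    have hh : h ∈ Submonoid.closure (T : Set H) := by rw [hT]; trivial
    induction hh using Submonoid.closure_induction_right with
    | one => simp
    | mul_right x _ t ht ih => exact ih.trans (step t ht x)
  by_cases hf : f ∈ g • V
  · exact Or.inl fun h hh => (all ⟨h, hh⟩).1 hf
  · exact Or.inr fun h hh hx => hf ((all ⟨h, hh⟩).2 hx)

theorem exists_not_crossing_of_hFinite (hHfg : H.FG) {V : Set G} (hV : IsEssential H V)
    {A : Set G} (hA : HFinite H A) :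
    ∃ Q : Set G, Q.Finite ∧ ∀ g, (∃ h ∈ H, ∃ q ∈ Q, ∃ h' ∈ H, g = h * q * h') ∨
      ∀ x ∈ A, ∀ y, y * x⁻¹ ∈ H → (x ∈ g • V ↔ y ∈ g • V) := by
  obtain ⟨F, hF, hAF⟩ := hA
  choose Q hQ hVQ using fun f => hV.exists_not_crossing hHfg f
  refine ⟨⋃ f ∈ F, Q f, hF.biUnion fun f _ => hQ f, fun g => ?_⟩
  refine or_iff_not_imp_left.2 fun hg x hx y hy => ?_
  obtain ⟨h, hh, f, hf, rfl⟩ := hAF hx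
  have hy' : y * f⁻¹ ∈ H := by simpa [mul_assoc] using H.mul_mem hy hh
  rcases hVQ f g with ⟨a, ha, q, hq, b, hb, he⟩ | hall | hall
  · exact (hg ⟨a, ha, q, Set.mem_biUnion hf hq, b, hb, he⟩).elim
  · exact iff_of_true (hall h hh) (by simpa using hall _ hy')
  · exact iff_of_false (hall h hh) (by simpa using hall _ hy')

/-- Away from finitely many double cosets, almost inclusions are inclusions. -/
theorem exists_subset_of_almost_subset [Infinite H] (hGfg : Group.FG G) (hHfg : H.FG) {U V : Set G}
    (hU : IsEssential H U) (hV : IsEssential H V) :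
    ∃ Q : Set G, Q.Finite ∧ ∀ g, (∃ h ∈ H, ∃ q ∈ Q, ∃ h' ∈ H, g = h * q * h') ∨
      ((U \ g • V).Finite → U ⊆ g • V) := by
  have hfg : Monoid.FG G := Group.fg_iff_monoid_fg.1 hGfg
  obtain ⟨S, hS⟩ := hfg.fg_top
  have hcob : ∀ W, IsEssential H W → HFinite H (⋃ s ∈ (S : Set G), {x | ¬ (x ∈ W ↔ x * s ∈ W)}) :=
    fun W hW => hFinite_biUnion S.finite_toSet fun s _ => hW.hFinite_coboundary s
  obtain ⟨Q, hQ, hQV⟩ := exists_not_crossing_of_hFinite hHfg hV (hcob U hU)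
  obtain ⟨R, hR, hRU⟩ := exists_not_crossing_of_hFinite hHfg hU (hcob V hV)
  refine ⟨Q ∪ R⁻¹, hQ.union hR.inv, fun g => ?_⟩
  refine or_iff_not_imp_left.2 fun hg hfin => ?_
  have hV' := (hQV g).resolve_left fun ⟨h, hh, q, hq, h', hh', he⟩ =>
    hg ⟨h, hh, q, Or.inl hq, h', hh', he⟩
  have hU' := (hRU g⁻¹).resolve_left fun ⟨h, hh, q, hq, h', hh', he⟩ =>
    hg ⟨h'⁻¹, H.inv_mem hh', q⁻¹, Or.inr (by simpa using hq), h⁻¹, H.inv_mem hh, by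
      rw [← inv_inv g, he]; group⟩
  -- A generator leading out of `U \ g • V` at `x` crosses the coboundary of `U` or of `g • V`. Then
  -- a whole coset, `Hx` or `gHg⁻¹x` respectively, lies in the difference, since the other set does
  -- not cut it; but the difference is finite.
  have step : ∀ x ∈ U \ g • V, ∀ s ∈ S, x * s ∈ U \ g • V := by
    rintro x ⟨hxU, hxV⟩ s hs
    by_contra hxs
    by_cases hxsU : x * s ∈ U
    · have hxsV : x * s ∈ g • V := by
        by_contra h
        exact hxs ⟨hxsU, h⟩
      have hmem : g⁻¹ * x ∈ ⋃ s ∈ (S : Set G), {x | ¬ (x ∈ V ↔ x * s ∈ V)} := by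
        rw [Set.mem_smul_set_iff_inv_smul_mem, smul_eq_mul] at hxV hxsV
        exact Set.mem_biUnion hs fun h => hxV (h.2 (by rwa [mul_assoc]))
      have hinf : (g • {y | y * (g⁻¹ * x)⁻¹ ∈ H}).Infinite := (infinite_coset _).smul_set
      refine hinf (hfin.subset ?_)
      rintro _ ⟨y, hy, rfl⟩
      refine ⟨?_, fun hyV => hxV ?_⟩
      · have := (hU' _ hmem y hy).1 (by simpa [Set.mem_smul_set_iff_inv_smul_mem] using hxU)
        simpa [Set.mem_smul_set_iff_inv_smul_mem] using this
      · rw [Set.smul_mem_smul_set_iff] at hyV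
        rw [Set.mem_smul_set_iff_inv_smul_mem, smul_eq_mul]
        have := (hV.mul_mem_iff _ hy (g⁻¹ * x)).1 (by simpa [-mul_inv_rev] using hyV)
        exact this
    · have hmem : x ∈ ⋃ s ∈ (S : Set G), {x | ¬ (x ∈ U ↔ x * s ∈ U)} :=
        Set.mem_biUnion hs fun h => hxsU (h.1 hxU)
      refine infinite_coset (H := H) x (hfin.subset fun y hy => ?_)
      exact ⟨hU.coset_subset hxU hy, fun h => hxV ((hV' x hmem y hy).2 h)⟩
  by_contra hnot
  obtain ⟨x, hx⟩ := Set.nonempty_of_not_subset hnot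
  have hall : ∀ y : G, x * y ∈ U \ g • V := by
    intro y
    have hy : y ∈ Submonoid.closure (S : Set G) := by rw [hS]; trivial
    induction hy using Submonoid.closure_induction_right with
    | one => simpa using hx
    | mul_right y _ s hs ih => simpa [mul_assoc] using step _ ih s hs
  refine hU.infinite (hfin.subset fun y _ => ?_)
  simpa using hall (x⁻¹ * y)

/-- If `U` is almost contained in a translate of `V`, then it lies in a neighbourhood of that
translate of uniformly bounded size. -/
theorem exists_uniform_neighborhood [Infinite H] (hGfg : Group.FG G) (hHfg : H.FG) {U V : Set G}
    (hU : IsEssential H U) (hV : IsEssential H V) :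
    ∃ K : Set G, K.Finite ∧ ∀ g : G, (U \ g • V).Finite → ∀ x ∈ U, ∃ k ∈ K, x * k ∈ g • V := by
  classical
  obtain ⟨Q, hQ, hUV⟩ := exists_subset_of_almost_subset hGfg hHfg hU hV
  obtain ⟨z, hz⟩ := hV.nonempty
  -- For `g = h * q * h'` the difference `U \ g • V` is `h • (U \ q • V)`. A point `h * y` of it is
  -- moved by `y⁻¹ * (q * z)` to `h * q * z`, which lies in `g • V`.
  refine ⟨{1} ∪ ⋃ q ∈ Q, if (U \ q • V).Finite then (fun x => x⁻¹ * (q * z)) '' (U \ q • V) else ∅,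
    (Set.finite_singleton 1).union (hQ.biUnion fun q _ => ?_), fun g hfin x hx => ?_⟩
  · split_ifs with h
    · exact h.image _
    · exact Set.finite_empty
  by_cases hxV : x ∈ g • V
  · exact ⟨1, Or.inl rfl, by simpa using hxV⟩
  rcases hUV g with ⟨h, hh, q, hq, h', hh', rfl⟩ | hsub
  · have heq : U \ (h * q * h') • V = h • (U \ q • V) := by
      rw [Set.smul_set_sdiff, hU.smul_eq hh, mul_smul, mul_smul, hV.smul_eq hh']
    have hqfin : (U \ q • V).Finite := by
      rw [heq] at hfin
      simpa using hfin.smul_set (a := h⁻¹)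
    have hxmem : x ∈ h • (U \ q • V) := heq ▸ (⟨hx, hxV⟩ : x ∈ U \ (h * q * h') • V)
    obtain ⟨y, hy, rfl⟩ := hxmem
    refine ⟨y⁻¹ * (q * z), Or.inr ?_, ?_⟩
    · refine Set.mem_biUnion hq ?_
      rw [if_pos hqfin]
      exact ⟨y, hy, rfl⟩
    · rw [mul_smul, mul_smul, hV.smul_eq hh']
      refine ⟨q * z, ⟨z, hz, rfl⟩, ?_⟩
      simp [mul_assoc]
  · exact (hxV (hsub hfin hx)).elim

theorem IsEssential.exists_deep_point {U : Set G} (hU : IsEssential H U) {K : Set G}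
    (hK : K.Finite) : ∃ p ∈ U, ∀ k ∈ K, p * k ∈ U := by
  by_contra! hcon
  refine hU.not_hFinite ((hFinite_biUnion hK fun k _ => hU.hFinite_coboundary k).mono ?_)
  intro x hx
  obtain ⟨k, hk, hxk⟩ := hcon x hx
  exact Set.mem_biUnion hk fun h => hxk (h.1 hx)

/-- If `g • V` separates `p` from `q`, then `p` is in its coboundary for `p⁻¹ * q`. So `g⁻¹ * p`
lies in one of finitely many cosets `Hf`, and `f` determines the translate. -/
theorem IsEssential.finite_separating {V : Set G} (hV : IsEssential H V) (p q : G) :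
    {W : Set G | (∃ g : G, W = g • V) ∧ p ∈ W ∧ q ∉ W}.Finite := by
  obtain ⟨F, hF, hVF⟩ := hV.hFinite_coboundary (p⁻¹ * q)
  refine (hF.image fun f => (p * f⁻¹) • V).subset ?_
  rintro _ ⟨⟨g, rfl⟩, hp, hq⟩
  have hmem : p ∈ {x | ¬ (x ∈ g • V ↔ x * (p⁻¹ * q) ∈ g • V)} :=
    fun h => hq (by simpa using h.1 hp)
  rw [coboundary_smul, Set.mem_smul_set_iff_inv_smul_mem] at hmem
  obtain ⟨h, hh, f, hf, he⟩ := hVF hmem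
  refine ⟨f, hf, ?_⟩
  have hg : g = p * f⁻¹ * h⁻¹ := by
    simp only [smul_eq_mul] at he
    have : p = g * (h * f) := by rw [he]; group
    rw [this]; group
  rw [hg, mul_smul, hV.smul_eq (H.inv_mem hh)]

/-- Some translate of `H` meets the essential set `U` in an infinite set. -/
theorem IsEssential.exists_not_finite_inter_smul [Infinite H] (hHfg : H.FG) {U : Set G}
    (hU : IsEssential H U) : ∃ g ∉ H, ¬ ∀ B, HFinite H B → (U ∩ g • B).Finite := by
  by_contra! hcon
  have hHfin : HFinite H (H : Set G) := by simpa using hFinite_coset H 1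
  have hfg : Monoid.FG H := Group.fg_iff_monoid_fg.1 ((Group.fg_iff_subgroup_fg H).2 hHfg)
  obtain ⟨T, hT⟩ := hfg.fg_top
  obtain ⟨F, hF, hUF⟩ := hFinite_biUnion T.finite_toSet fun t _ => hU.hFinite_coboundary (t : G)
  -- By assumption `xH` is not contained in `U`. Since `H` is finitely generated, moving along `xH`
  -- from `x` meets the coboundary of `U`, which lies in `HF`.
  have hreach : ∀ x ∈ U, x ∉ H → ∃ h ∈ H, ∃ f ∈ F, ∃ h' ∈ H, x = h * f * h' := by
    intro x hx hxH
    by_contra! hno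
    have step : ∀ h : H, x * h ∈ U := by
      intro h
      have hh : h ∈ Submonoid.closure (T : Set H) := by rw [hT]; trivial
      induction hh using Submonoid.closure_induction_right with
      | one => simpa using hx
      | mul_right y _ t ht ih =>
        by_contra hy
        have hmem : x * y ∈ ⋃ t ∈ (T : Set H), {x | ¬ (x ∈ U ↔ x * (t : G) ∈ U)} :=
          Set.mem_biUnion ht fun h => hy (by simpa [mul_assoc] using h.1 ih)
        obtain ⟨h, hh, f, hf, he⟩ := hUF hmem
        refine hno h hh f hf (y : G)⁻¹ (H.inv_mem y.2) ?_
        simp only at he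
        rw [he]; group
    have hinf : (x • (H : Set G)).Infinite := by
      have : (H : Set G).Infinite := Set.infinite_coe_iff.1 ‹Infinite H›
      exact this.smul_set
    refine hinf ((hcon x hxH _ hHfin).subset ?_)
    rintro _ ⟨h, hh, rfl⟩
    exact ⟨step ⟨h, hh⟩, h, hh, rfl⟩
  have hDfin : HFinite H (⋃ f ∈ F \ H,
      {x | ∃ h ∈ H, ∃ y ∈ U ∩ f • (H : Set G), x = h * y}) := by
    refine hFinite_biUnion hF.sdiff fun f hf => ?_
    refine ⟨U ∩ f • (H : Set G), hcon f hf.2 _ hHfin, ?_⟩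
    rintro x ⟨h, hh, y, hy, rfl⟩
    exact ⟨h, hh, y, hy, rfl⟩
  refine hU.not_hFinite ((hHfin.union hDfin).mono fun x hx => ?_)
  by_cases hxH : x ∈ H
  · exact Or.inl hxH
  right
  obtain ⟨h, hh, f, hf, h', hh', rfl⟩ := hreach x hx hxH
  refine Set.mem_biUnion (x := f) ⟨hf, fun hfH => hxH (H.mul_mem (H.mul_mem hh hfH) hh')⟩ ?_
  refine ⟨h, hh, f * h', ⟨?_, h', hh', rfl⟩, by group⟩
  exact (hU.mul_mem_iff h hh _).1 (by simpa [mul_assoc] using hx)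

end Essential

/-! ### The tree of translates -/

section Translates

variable {G : Type*} [Group G] {H : Subgroup G}

/-- The translates of a set and of its complement. -/
def Translates (X : Set G) : Type _ := {Y : Set G // ∃ g : G, Y = g • X ∨ Y = g • Xᶜ}

/-- The hypotheses on `X` under which its translates are nested. -/
structure HasNestedTranslates (H : Subgroup G) (X : Set G) : Prop where
  fg_group : Group.FG G
  fg_subgroup : H.FG
  groupEnds_group : groupEnds G = 1
  groupEnds_subgroup : groupEnds H = 1
  almostMalnormal : AlmostMalnormal H
  isEssential : IsEssential H X

namespace HasNestedTranslates

variable {X : Set G}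

theorem infinite_subgroup (hX : HasNestedTranslates H X) : Infinite H :=
  infinite_of_groupEnds_eq_one hX.groupEnds_subgroup

theorem exists_eq_smul (hX : HasNestedTranslates H X) (Y : Translates X) :
    ∃ (g : G) (U : Set G), (U = X ∨ U = Xᶜ) ∧ IsEssential H U ∧ Y.1 = g • U := by
  obtain ⟨Y, g, h | h⟩ := Y
  · exact ⟨g, X, Or.inl rfl, hX.isEssential, h⟩
  · exact ⟨g, Xᶜ, Or.inr rfl, hX.isEssential.compl, h⟩

theorem smul_sdiff_smul_finite {a b : G} {U V : Set G} (h : (a • U \ b • V).Finite) :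
    (U \ (a⁻¹ * b) • V).Finite := by
  have := h.smul_set (a := a⁻¹)
  rwa [Set.smul_set_sdiff, inv_smul_smul, smul_smul] at this

theorem infinite_translate (hX : HasNestedTranslates H X) (Y : Translates X) : Y.1.Infinite := by
  obtain ⟨g, U, -, hU, h⟩ := hX.exists_eq_smul Y
  rw [h]
  exact hU.infinite.smul_set

theorem eq_of_finite_sdiff (hX : HasNestedTranslates H X) {Y Z : Translates X}
    (h1 : (Y.1 \ Z.1).Finite) (h2 : (Z.1 \ Y.1).Finite) : Y = Z := by
  obtain ⟨a, U, hUX, hU, hY⟩ := hX.exists_eq_smul Y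
  obtain ⟨b, V, hVX, hV, hZ⟩ := hX.exists_eq_smul Z
  have hYinf := hX.infinite_translate Y
  apply Subtype.ext
  by_cases hab : a⁻¹ * b ∈ H
  · have hbV : b • V = a • V := by
      conv_rhs => rw [← hV.smul_eq hab, smul_smul, mul_inv_cancel_left]
    by_cases hUV : U = V
    · rw [hY, hZ, hbV, hUV]
    · have hc : V = Uᶜ := by
        rcases hUX with rfl | rfl <;> rcases hVX with rfl | rfl <;> simp_all
      refine (hYinf (h1.subset fun x hx => ⟨hx, ?_⟩)).elim
      rw [hZ, hbV, hc, Set.smul_set_compl, ← hY]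
      exact fun h => h hx
  · rw [hY, hZ] at h1 h2
    refine (hU.not_almost_eq_smul hX.almostMalnormal hX.groupEnds_subgroup hV hab
      (smul_sdiff_smul_finite h1) ?_).elim
    have := h2.smul_set (a := a⁻¹)
    rwa [Set.smul_set_sdiff, inv_smul_smul, smul_smul] at this

/-- Translates ordered by almost inclusion. -/
@[reducible]
def partialOrder (hX : HasNestedTranslates H X) : PartialOrder (Translates X) where
  le Y Z := (Y.1 \ Z.1).Finite
  le_refl Y := by simp
  le_trans Y Z W h1 h2 := (h1.union h2).subset fun x hx => by
    by_cases hxZ : x ∈ Z.1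
    · exact Or.inr ⟨hxZ, hx.2⟩
    · exact Or.inl ⟨hx.1, hxZ⟩
  le_antisymm Y Z h1 h2 := hX.eq_of_finite_sdiff h1 h2

end HasNestedTranslates

namespace Translates

variable {X : Set G}

instance : MulAction G (Translates X) where
  smul g Y := ⟨g • Y.1, by
    obtain ⟨a, h | h⟩ := Y.2
    · exact ⟨g * a, Or.inl (by rw [mul_smul, ← h])⟩
    · exact ⟨g * a, Or.inr (by rw [mul_smul, ← h])⟩⟩
  one_smul Y := Subtype.ext (one_smul G Y.1)
  mul_smul a b Y := Subtype.ext (mul_smul a b Y.1)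

theorem coe_smul (g : G) (Y : Translates X) : (g • Y).1 = g • Y.1 := rfl

/-- The complement of a translate. -/
def compl (Y : Translates X) : Translates X :=
  ⟨Y.1ᶜ, by
    obtain ⟨a, h | h⟩ := Y.2
    · exact ⟨a, Or.inr (by rw [h, Set.smul_set_compl])⟩
    · exact ⟨a, Or.inl (by rw [h, Set.smul_set_compl, _root_.compl_compl])⟩⟩

/-- The set itself, as a translate. -/
def base (X : Set G) : Translates X := ⟨X, 1, Or.inl (one_smul G X).symm⟩

end Translates

namespace HasNestedTranslates

variable {X : Set G}

theorem exists_uniform_neighborhood (hX : HasNestedTranslates H X) :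
    ∃ K : Set G, K.Finite ∧ ∀ Y Z : Translates X, (Y.1 \ Z.1).Finite →
      ∀ x ∈ Y.1, ∃ k ∈ K, x * k ∈ Z.1 := by
  have := hX.infinite_subgroup
  have key : ∀ U V, IsEssential H U → IsEssential H V → ∃ K : Set G, K.Finite ∧
      ∀ a b : G, (a • U \ b • V).Finite → ∀ x ∈ a • U, ∃ k ∈ K, x * k ∈ b • V := by
    intro U V hU hV
    obtain ⟨K, hK, hKUV⟩ :=
      GroupEnds.exists_uniform_neighborhood hX.fg_group hX.fg_subgroup hU hV
    refine ⟨K, hK, fun a b hab x hx => ?_⟩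
    obtain ⟨k, hk, hxk⟩ := hKUV _ (smul_sdiff_smul_finite hab) _
      (Set.mem_smul_set_iff_inv_smul_mem.1 hx)
    refine ⟨k, hk, ?_⟩
    rw [Set.mem_smul_set_iff_inv_smul_mem] at hxk ⊢
    simpa [mul_assoc] using hxk
  have hE := hX.isEssential
  obtain ⟨K₁, hK₁, h₁⟩ := key X X hE hE
  obtain ⟨K₂, hK₂, h₂⟩ := key X Xᶜ hE hE.compl
  obtain ⟨K₃, hK₃, h₃⟩ := key Xᶜ X hE.compl hE
  obtain ⟨K₄, hK₄, h₄⟩ := key Xᶜ Xᶜ hE.compl hE.compl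
  refine ⟨K₁ ∪ K₂ ∪ (K₃ ∪ K₄), (hK₁.union hK₂).union (hK₃.union hK₄), ?_⟩
  rintro ⟨Y, a, rfl | rfl⟩ ⟨Z, b, rfl | rfl⟩ h x hx
  · obtain ⟨k, hk, hxk⟩ := h₁ a b h x hx
    exact ⟨k, Or.inl (Or.inl hk), hxk⟩
  · obtain ⟨k, hk, hxk⟩ := h₂ a b h x hx
    exact ⟨k, Or.inl (Or.inr hk), hxk⟩
  · obtain ⟨k, hk, hxk⟩ := h₃ a b h x hx
    exact ⟨k, Or.inr (Or.inl hk), hxk⟩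
  · obtain ⟨k, hk, hxk⟩ := h₄ a b h x hx
    exact ⟨k, Or.inr (Or.inr hk), hxk⟩

theorem exists_deep_point (hX : HasNestedTranslates H X) (Y : Translates X) {K : Set G}
    (hK : K.Finite) : ∃ p ∈ Y.1, ∀ k ∈ K, p * k ∈ Y.1 := by
  obtain ⟨g, U, -, hU, hY⟩ := hX.exists_eq_smul Y
  obtain ⟨p, hp, hpK⟩ := hU.exists_deep_point hK
  rw [hY]
  refine ⟨g * p, ⟨p, hp, rfl⟩, fun k hk => ⟨p * k, hpK k hk, ?_⟩⟩
  simp [mul_assoc]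

/-- Only finitely many translates lie between two given ones. -/
theorem finite_between (hX : HasNestedTranslates H X) (Y Z : Translates X) :
    {W : Translates X | (Y.1 \ W.1).Finite ∧ (W.1 \ Z.1).Finite}.Finite := by
  obtain ⟨K, hK, hKX⟩ := hX.exists_uniform_neighborhood
  obtain ⟨p, hp, hpK⟩ := hX.exists_deep_point Y hK
  obtain ⟨q, hq, hqK⟩ := hX.exists_deep_point Z.compl hK
  have hfin := (hX.isEssential.finite_separating p q).union
    (hX.isEssential.compl.finite_separating p q)
  refine Set.Finite.subset (hfin.preimage (f := Subtype.val) Subtype.val_injective.injOn) ?_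
  rintro (W : Translates X) ⟨h1, h2⟩
  -- Otherwise `p` lies in `Wᶜ`, which is almost contained in `Yᶜ`, so some `p * k` leaves `Y`
  -- although `p` is deep in `Y`. The same argument with `Z` keeps `q` out of `W`; thus every `W` in
  -- between separates `p` from `q`.
  have hpW : p ∈ W.1 := by
    by_contra hpW
    obtain ⟨k, hk, hpk⟩ := hKX W.compl Y.compl (h1.subset fun x hx => ⟨by
      by_contra h; exact hx.2 h, hx.1⟩) p hpW
    exact hpk (hpK k hk)
  have hqW : q ∉ W.1 := by
    intro hqW
    obtain ⟨k, hk, hqk⟩ := hKX W Z h2 q hqW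
    exact hqK k hk hqk
  obtain ⟨W, a, rfl | rfl⟩ := W
  · exact Or.inl ⟨⟨a, rfl⟩, hpW, hqW⟩
  · exact Or.inr ⟨⟨a, rfl⟩, hpW, hqW⟩

theorem nested (hX : HasNestedTranslates H X) (Y Z : Translates X) :
    (Y.1 ∩ Z.1).Finite ∨ (Y.1 ∩ Z.1ᶜ).Finite ∨ (Y.1ᶜ ∩ Z.1).Finite ∨ (Y.1ᶜ ∩ Z.1ᶜ).Finite := by
  obtain ⟨a, U, hUX, hU, hY⟩ := hX.exists_eq_smul Y
  obtain ⟨b, V, hVX, hV, hZ⟩ := hX.exists_eq_smul Z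
  have hback : ∀ S T : Set G, (S ∩ (a⁻¹ * b) • T).Finite → (a • S ∩ b • T).Finite := by
    intro S T h
    have := h.smul_set (a := a)
    rwa [Set.smul_set_inter, smul_smul, mul_inv_cancel_left] at this
  have h4 : (U ∩ (a⁻¹ * b) • V).Finite ∨ (U ∩ (a⁻¹ * b) • Vᶜ).Finite ∨
      (Uᶜ ∩ (a⁻¹ * b) • V).Finite ∨ (Uᶜ ∩ (a⁻¹ * b) • Vᶜ).Finite := by
    by_cases hab : a⁻¹ * b ∈ H
    · rw [hV.smul_eq hab, hV.compl.smul_eq hab]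
      rcases hUX with rfl | rfl <;> rcases hVX with rfl | rfl <;> simp
    · exact exists_finite_corner hX.groupEnds_group hX.almostMalnormal hX.groupEnds_subgroup
        hU hV hab
  rw [hY, hZ, ← Set.smul_set_compl, ← Set.smul_set_compl]
  exact h4.imp (hback _ _) (Or.imp (hback _ _) (Or.imp (hback _ _) (hback _ _)))

theorem smul_base_eq_iff (hX : HasNestedTranslates H X) (g : G) :
    g • Translates.base X = Translates.base X ↔ g ∈ H := by
  constructor
  · intro h
    by_contra hg
    have hgX : g • X = X := congrArg Subtype.val h
    exact hX.isEssential.not_almost_eq_smul hX.almostMalnormal hX.groupEnds_subgroup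
      hX.isEssential hg (by simp [hgX]) (by simp [hgX])
  · intro hg
    exact Subtype.ext (hX.isEssential.smul_eq hg)

theorem isNestedOrbit (hX : HasNestedTranslates H X) :
    letI := hX.partialOrder
    IsNestedOrbit G Translates.compl (Translates.base X) := by
  let := hX.partialOrder
  have hle : ∀ Y Z : Translates X, Y ≤ Z ↔ (Y.1 \ Z.1).Finite := fun _ _ => Iff.rfl
  have hc : ∀ Y : Translates X, Y.compl.1 = Y.1ᶜ := fun _ => rfl
  refine ⟨?_, ?_, ?_, ?_, ?_, ?_, ?_, ?_, ?_⟩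
  · exact fun Y => Subtype.ext (_root_.compl_compl Y.1)
  · intro Y Z h
    rw [hle, hc, hc]
    exact Set.Finite.subset h fun x hx => ⟨by by_contra h; exact hx.2 h, hx.1⟩
  · intro g Y Z h
    rw [hle, Translates.coe_smul, Translates.coe_smul, ← Set.smul_set_sdiff]
    exact Set.Finite.smul_set h
  · exact fun g Y => Subtype.ext Set.smul_set_compl
  · intro Y Z
    simp only [hle, hc, Set.sdiff_eq, _root_.compl_compl]
    have := hX.nested Y Z
    tauto
  · intro Y Z h1 h2
    refine hX.infinite_translate Y ((Set.Finite.union h1 h2).subset fun x hx => ?_)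
    by_cases hxZ : x ∈ Z.1
    · exact Or.inr ⟨hx, fun h => h hxZ⟩
    · exact Or.inl ⟨hx, hxZ⟩
  · exact hX.finite_between
  · rintro ⟨Y, g, h | h⟩
    · exact ⟨g, Or.inl (Subtype.ext h)⟩
    · exact ⟨g, Or.inr (Subtype.ext h)⟩
  · intro g h
    have hg : g • X = Xᶜ := congrArg Subtype.val h
    by_cases hgH : g ∈ H
    · rw [hX.isEssential.smul_eq hgH] at hg
      obtain ⟨x, hx⟩ := hX.isEssential.nonempty
      exact (hg ▸ hx : x ∈ Xᶜ) hx
    · exact hX.isEssential.compl.not_almost_eq_smul hX.almostMalnormal hX.groupEnds_subgroup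
        hX.isEssential hgH (by simp [hg]) (by simp [hg])

/-- Some `gH` with `g ∉ H` meets `Y` in an infinite set, hence lies almost inside `Y`. The side of
`gX` that contains almost nothing of `H` then has a finite corner with `Yᶜ`, so it is below `Y`. -/
theorem exists_lt (hX : HasNestedTranslates H X) (Y : Translates X) (hY : Y.1 = X ∨ Y.1 = Xᶜ) :
    letI := hX.partialOrder
    ∃ Z, Z < Y := by
  let := hX.partialOrder
  have := hX.infinite_subgroup
  have hU : IsEssential H Y.1 := by
    rcases hY with h | h <;> rw [h]
    · exact hX.isEssential
    · exact hX.isEssential.compl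
  obtain ⟨g, hg, hinf⟩ := hU.exists_not_finite_inter_smul hX.fg_subgroup
  have h2 := (hU.smul_inter_finite_or hX.almostMalnormal hX.groupEnds_subgroup hg).resolve_left hinf
  have key : ∀ V, (V = X ∨ V = Xᶜ) → IsEssential H V → (∀ A, HFinite H A → (A ∩ g • V).Finite) →
      ∃ Z, Z < Y := by
    intro V hVX hV h1
    have h3 := finite_corner hX.groupEnds_group hU.compl hV h1 h2
    refine ⟨⟨g • V, g, hVX.imp (congrArg _) (congrArg _)⟩, lt_of_le_of_ne ?_ fun h => ?_⟩
    · exact h3.subset fun x hx => ⟨hx.2, hx.1⟩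
    · have hgV : g • V = Y.1 := congrArg Subtype.val h
      exact hU.not_almost_eq_smul hX.almostMalnormal hX.groupEnds_subgroup hV hg
        (by simp [hgV]) (by simp [hgV])
  rcases hX.isEssential.inter_smul_finite_or hX.almostMalnormal hX.groupEnds_subgroup hg with h | h
  · exact key X (Or.inl rfl) hX.isEssential h
  · exact key Xᶜ (Or.inr rfl) hX.isEssential.compl h

theorem splitsOver (hX : HasNestedTranslates H X) : SplitsOver H :=
  letI := hX.partialOrder
  hX.isNestedOrbit.splitsOver hX.smul_base_eq_iff (hX.exists_lt _ (Or.inl rfl))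
    (hX.exists_lt _ (Or.inr rfl))

end HasNestedTranslates

end Translates

end GroupEnds

theorem theorem3p3 {G : Type*} [Group G] (hG : Group.FG G) (H : Subgroup G) (hH : H.FG)
    (hGends : GroupEnds.groupEnds G = 1) (hHends : GroupEnds.groupEnds H = 1)
    (hGH : 2 ≤ GroupEnds.pairEnds H) (hmal : GroupEnds.AlmostMalnormal H) :
    GroupEnds.SplitsOver H := by
  obtain ⟨X, hX, h1, h2⟩ := GroupEnds.exists_not_hFinite_of_two_le_pairEnds hGH
  exact GroupEnds.HasNestedTranslates.splitsOver
    ⟨hG, hH, hGends, hHends, hmal, hX.isEssential h1 h2⟩
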